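/- A hidden stochastic game is given by a finite state space $K$, nonempty finite action sets $I$ and $J$, a finite set of public signals $A$, a transition function $q : K\times I\times J\to\Delta(K\times A)$ and a payoff function $g : K\times I\times J\to\mathbb{R}$. Given $p_1\in\Delta(K)$, known to both players, the initial state $k_1$ is drawn from $p_1$ and is not observed. At each stage $m\ge 1$, Player 1 and Player 2 simultaneously choose $i_m\in I$ and $j_m\in J$, the payoff of Player 1 is $g_m=g(k_m,i_m,j_m)$ (Player 2 receives $-g_m$, and payoffs are not observed), the pair $(k_{m+1},a_m)$ is drawn from $q(k_m,i_m,j_m)$, and $(i_m,j_m,a_m)$ is publicly announced. A behavioral strategy of Player 1 (resp. 2) assigns an element of $\Delta(I)$ (resp. $\Delta(J)$) to every finite public history $(i_1,j_1,a_1,\dots,i_{m-1},j_{m-1},a_{m-1})$, $m\ge1$. For strategies $\sigma,\tau$, for $n\ge 1$ and $\lambda\in(0,1]$, let $$\gamma_n^{p_1}(\sigma,\tau)=\mathbb{E}^{p_1}_{\sigma,\tau}\Big[\frac1n\sum_{m=1}^n g_m\Big],\qquad \gamma_\lambda^{p_1}(\sigma,\tau)=\mathbb{E}^{p_1}_{\sigma,\tau}\Big[\sum_{m\ge1}\lambda(1-\lambda)^{m-1}g_m\Big].$$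 For every hidden stochastic game, every $n\ge1$, every $\lambda\in(0,1]$ and every $p_1\in\Delta(K)$, the $n$-stage game and the $\lambda$-discounted game have a value: $$v_n(p_1)=\sup_\sigma\inf_\tau\gamma_n^{p_1}(\sigma,\tau)=\inf_\tau\sup_\sigma\gamma_n^{p_1}(\sigma,\tau),\qquad v_\lambda(p_1)=\sup_\sigma\inf_\tau\gamma_\lambda^{p_1}(\sigma,\tau)=\inf_\tau\sup_\sigma\gamma_\lambda^{p_1}(\sigma,\tau),$$ and the following two statements are equivalent: (a) for all $p_1\in\Delta(K)$, $(v_n(p_1))$ converges when $n$ goes to infinity; (b) for all $p_1\in\Delta(K)$, $(v_\lambda(p_1))$ converges when $\lambda$ goes to $0$. Moreover, when these statements hold, $\lim_{n\to+\infty}v_n(p_1)=\lim_{\lambda\to0}v_\lambda(p_1)$ for all $p_1\in\Delta(K)$. -/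

import Mathlib

open Filter Topology

/-- The lower value `sup_s inf_t γ(s, t)` of the zero-sum game in normal form `(S, T, γ)`, where
the first player maximizes. -/
noncomputable def lowerValue {S T : Type*} (γ : S → T → ℝ) : ℝ := ⨆ s, ⨅ t, γ s t

/-- The upper value `inf_t sup_s γ(s, t)` of the zero-sum game in normal form `(S, T, γ)`. -/
noncomputable def upperValue {S T : Type*} (γ : S → T → ℝ) : ℝ := ⨅ t, ⨆ s, γ s t

/-- A hidden stochastic game with state space `K`, action sets `I` (Player 1) and `J` (Player 2)
and set of public signals `A`. Both players observe the past actions and the public signals, and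
nothing else. -/
structure HiddenStochasticGame (K I J A : Type*) [Fintype K] [Fintype A] where
  /-- `transition k i j` is the joint law of the next state and of the public signal, when the
  actions `i`, `j` are played in state `k`. -/
  transition : K → I → J → stdSimplex ℝ (K × A)
  /-- The stage payoff of Player 1 (Player 2 gets the opposite). -/
  payoff : K → I → J → ℝ

namespace HiddenStochasticGame

/-- A public history: the actions and public signals `(i_m, j_m, a_m)` of the past stages,
the most recent stage first. -/
abbrev History (I J A : Type*) := List (I × J × A)

/-- Behavioral strategies of Player 1: a mixed action after every public history. -/
abbrev Strategy₁ (I J A : Type*) [Fintype I] := History I J A → stdSimplex ℝ I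

/-- Behavioral strategies of Player 2: a mixed action after every public history. -/
abbrev Strategy₂ (I J A : Type*) [Fintype J] := History I J A → stdSimplex ℝ J

variable {K I J A : Type*} [Fintype K] [Fintype I] [Fintype J] [Fintype A]

/-- `G.prob p σ τ h k` is the probability, when the initial state is drawn from `p` and the
players use `σ` and `τ`, that the first stages produce the public history `h` and that
the state which is then reached is `k`. -/
noncomputable def prob (G : HiddenStochasticGame K I J A) (p : stdSimplex ℝ K)
    (σ : Strategy₁ I J A) (τ : Strategy₂ I J A) : History I J A → K → ℝ
  | [], k => p.1 k
  | (i, j, a) :: h, k' =>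
      ∑ k, G.prob p σ τ h k * (σ h).1 i * (τ h).1 j * (G.transition k i j).1 (k', a)

/-- `G.stagePayoff p σ τ m` is the expectation of the payoff `g_{m+1}` of stage `m + 1`, the stage
which is preceded by a public history of length `m`. -/
noncomputable def stagePayoff (G : HiddenStochasticGame K I J A) (p : stdSimplex ℝ K)
    (σ : Strategy₁ I J A) (τ : Strategy₂ I J A) (m : ℕ) : ℝ :=
  ∑ h : List.Vector (I × J × A) m, ∑ k, ∑ i, ∑ j,
    G.prob p σ τ h.toList k * (σ h.toList).1 i * (τ h.toList).1 j * G.payoff k i j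

/-- The payoff in the `n`-stage game: the expectation of `n⁻¹ ∑_{m=1}^n g_m`. -/
noncomputable def nStagePayoff (G : HiddenStochasticGame K I J A) (n : ℕ) (p : stdSimplex ℝ K)
    (σ : Strategy₁ I J A) (τ : Strategy₂ I J A) : ℝ :=
  (n : ℝ)⁻¹ * ∑ m ∈ Finset.range n, G.stagePayoff p σ τ m

/-- The payoff in the discounted game: the expectation of `∑_{m≥1} lam (1 - lam)^(m-1) g_m`,
the series of the expectations being absolutely convergent for `0 < lam ≤ 1` because the
stage payoffs are bounded. -/
noncomputable def discountedPayoff (G : HiddenStochasticGame K I J A) (lam : ℝ)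
    (p : stdSimplex ℝ K) (σ : Strategy₁ I J A) (τ : Strategy₂ I J A) : ℝ :=
  ∑' m : ℕ, lam * (1 - lam) ^ m * G.stagePayoff p σ τ m

/-- The value `v_n(p)` of the `n`-stage game with initial belief `p`. It is defined as the lower
value; that the lower and upper values agree is a separate claim. -/
noncomputable def nStageValue (G : HiddenStochasticGame K I J A) (n : ℕ)
    (p : stdSimplex ℝ K) : ℝ :=
  lowerValue (G.nStagePayoff n p)

/-- The value `v_lam(p)` of the discounted game with initial belief `p`. It is defined as the
lower value; that the lower and upper values agree is a separate claim. -/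
noncomputable def discountedValue (G : HiddenStochasticGame K I J A) (lam : ℝ)
    (p : stdSimplex ℝ K) : ℝ :=
  lowerValue (G.discountedPayoff lam p)

end HiddenStochasticGame

/-! Write C for `payoffBound`. With the public belief as state variable, the game becomes a
stochastic game whose state both players know. Backward induction over matrix games (`finiteValue`,
`exists_optimal_strategies`) gives the value of any game with finitely many weighted stages. The
discounted value is a limit of such values, because the stages after the N-th weigh only (1 - λ)^N
in total.

The comparison of the two families is dynamic. Since the value of a matrix game is nonexpansive in
its entries, a uniform bound on m |v_m - v_λ| passes to (m + 1) |v_{m+1} - v_λ| at the cost of at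
most 2C |1 - (m + 1)λ|. If λ is about 1/n and m runs through the last n/q stages before n, each cost
is O(1/q). After division by n, going from n - n/q to n multiplies the uniform distance to v_λ by at
most 1 - 1/(2q) and adds O(1/q²) (`blockContraction`). Such a contraction has a fixed point of size
O(1/q).

The values are equi-Lipschitz in the belief and the simplex is compact, so pointwise convergence is
uniform. When one family converges uniformly to f, it can be replaced by f in the contraction
inequality; the other family then ends up within O(1/q) of f, for every q
(`BlockContraction.uniform_discounted`, `BlockContraction.uniform_nStage`). -/

/-! ### Zero-sum games in normal form. -/

section NormalForm

variable {S T : Type*}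

/-- If two strategies guarantee the same amount up to `ε`, the lower and upper values are
`ε`-close to this amount. -/
theorem value_bounds [Nonempty S] [Nonempty T] {γ : S → T → ℝ} {B v ε : ℝ}
    (hB : ∀ s t, |γ s t| ≤ B) (s₀ : S) (t₀ : T)
    (hs : ∀ t, v - ε ≤ γ s₀ t) (ht : ∀ s, γ s t₀ ≤ v + ε) :
    v - ε ≤ lowerValue γ ∧ lowerValue γ ≤ upperValue γ ∧ upperValue γ ≤ v + ε := by
  have bb : ∀ s, BddBelow (Set.range fun t => γ s t) := fun s =>
    ⟨-B, by rintro _ ⟨t, rfl⟩; exact (abs_le.1 (hB s t)).1⟩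
  have ba : ∀ t, BddAbove (Set.range fun s => γ s t) := fun t =>
    ⟨B, by rintro _ ⟨s, rfl⟩; exact (abs_le.1 (hB s t)).2⟩
  refine ⟨?_, ?_, ?_⟩
  · refine (le_ciInf hs).trans (le_ciSup (f := fun s => ⨅ t, γ s t) ⟨B, ?_⟩ s₀)
    rintro _ ⟨s, rfl⟩
    exact (ciInf_le (bb s) t₀).trans (abs_le.1 (hB s t₀)).2
  · refine ciSup_le fun s => le_ciInf fun t => ?_
    exact (ciInf_le (bb s) t).trans (le_ciSup (ba t) s)
  · refine (ciInf_le (f := fun t => ⨆ s, γ s t) ⟨-B, ?_⟩ t₀).trans (ciSup_le ht)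
    rintro _ ⟨t, rfl⟩
    exact (abs_le.1 (hB s₀ t)).1.trans (le_ciSup (ba t) s₀)

end NormalForm

/-! ### Matrix games: minimax theorem, monotonicity and homogeneity of the value. -/

namespace MatrixGame

variable {I J : Type*} [Fintype I] [Fintype J]

/-- The expected entry of the matrix `M` under the mixed actions `x` and `y`. -/
def mixed (x : stdSimplex ℝ I) (y : stdSimplex ℝ J) (M : I → J → ℝ) : ℝ :=
  ∑ i, ∑ j, x.1 i * y.1 j * M i j

theorem mixed_mono (x : stdSimplex ℝ I) (y : stdSimplex ℝ J) {M M' : I → J → ℝ}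
    (h : ∀ i j, M i j ≤ M' i j) : mixed x y M ≤ mixed x y M' :=
  Finset.sum_le_sum fun i _ => Finset.sum_le_sum fun j _ =>
    mul_le_mul_of_nonneg_left (h i j) (mul_nonneg (x.2.1 i) (y.2.1 j))

theorem mixed_add (x : stdSimplex ℝ I) (y : stdSimplex ℝ J) (M M' : I → J → ℝ) :
    mixed x y (fun i j => M i j + M' i j) = mixed x y M + mixed x y M' := by
  simp only [mixed, mul_add, Finset.sum_add_distrib]

theorem mixed_smul (x : stdSimplex ℝ I) (y : stdSimplex ℝ J) (c : ℝ) (M : I → J → ℝ) :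
    mixed x y (fun i j => c * M i j) = c * mixed x y M := by
  simp only [mixed, Finset.mul_sum]
  exact Finset.sum_congr rfl fun i _ => Finset.sum_congr rfl fun j _ => by ring

theorem mixed_const (x : stdSimplex ℝ I) (y : stdSimplex ℝ J) (c : ℝ) :
    mixed x y (fun _ _ => c) = c := by
  simp only [mixed]
  simp_rw [← Finset.sum_mul, ← Finset.mul_sum, y.2.2, mul_one, x.2.2, one_mul]

/-- Sion's theorem for a bilinear payoff on two compact simplices. -/
theorem exists_saddle [Nonempty I] [Nonempty J] (M : I → J → ℝ) :
    ∃ (v : ℝ) (x : stdSimplex ℝ I) (y : stdSimplex ℝ J),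
      (∀ y', v ≤ mixed x y' M) ∧ ∀ x', mixed x' y M ≤ v := by
  -- The minimizer's variable comes first: Sion's theorem wants quasiconvexity in the first
  -- argument.
  let f : (J → ℝ) → (I → ℝ) → ℝ := fun y x => ∑ i, ∑ j, x i * y j * M i j
  have hc₁ : ∀ x, Continuous fun y => f y x := fun x => by fun_prop
  have hc₂ : ∀ y, Continuous fun x => f y x := fun y => by fun_prop
  have hl₁ : ∀ x, IsLinearMap ℝ fun y => f y x := fun x =>
    { map_add := fun a b => by
        simp only [f, Pi.add_apply, mul_add, add_mul, Finset.sum_add_distrib]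
      map_smul := fun c a => by
        simp only [f, Pi.smul_apply, smul_eq_mul, Finset.mul_sum]
        exact Finset.sum_congr rfl fun i _ => Finset.sum_congr rfl fun j _ => by ring }
  have hl₂ : ∀ y, IsLinearMap ℝ fun x => f y x := fun y =>
    { map_add := fun a b => by
        simp only [f, Pi.add_apply, add_mul, Finset.sum_add_distrib]
      map_smul := fun c a => by
        simp only [f, Pi.smul_apply, smul_eq_mul, Finset.mul_sum]
        exact Finset.sum_congr rfl fun i _ => Finset.sum_congr rfl fun j _ => by ring }
  obtain ⟨y, hy, x, hx, h⟩ := Sion.exists_isSaddlePointOn (X := stdSimplex ℝ J)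
    (Y := stdSimplex ℝ I) (f := f) Set.Nonempty.of_subtype (convex_stdSimplex ℝ J)
    (isCompact_stdSimplex ℝ J) (fun x _ => (hc₁ x).lowerSemicontinuous.lowerSemicontinuousOn _)
    (fun x _ => ((hl₁ x).mk' _).convexOn (convex_stdSimplex ℝ J) |>.quasiconvexOn)
    (convex_stdSimplex ℝ I) Set.Nonempty.of_subtype (isCompact_stdSimplex ℝ I)
    (fun y _ => (hc₂ y).upperSemicontinuous.upperSemicontinuousOn _)
    (fun y _ => ((hl₂ y).mk' _).concaveOn (convex_stdSimplex ℝ I) |>.quasiconcaveOn)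
  exact ⟨f y x, ⟨x, hx⟩, ⟨y, hy⟩, fun y' => h _ y'.2 _ hx, fun x' => h _ hy _ x'.2⟩

variable [Nonempty I] [Nonempty J]

/-- The value of the matrix game `M` in mixed actions. -/
noncomputable def value (M : I → J → ℝ) : ℝ := (exists_saddle M).choose

/-- An optimal mixed action of the maximizer. -/
noncomputable def opt₁ (M : I → J → ℝ) : stdSimplex ℝ I := (exists_saddle M).choose_spec.choose

/-- An optimal mixed action of the minimizer. -/
noncomputable def opt₂ (M : I → J → ℝ) : stdSimplex ℝ J :=
  (exists_saddle M).choose_spec.choose_spec.choose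

theorem value_le_mixed (M : I → J → ℝ) (y : stdSimplex ℝ J) : value M ≤ mixed (opt₁ M) y M :=
  (exists_saddle M).choose_spec.choose_spec.choose_spec.1 y

theorem mixed_le_value (M : I → J → ℝ) (x : stdSimplex ℝ I) : mixed x (opt₂ M) M ≤ value M :=
  (exists_saddle M).choose_spec.choose_spec.choose_spec.2 x

/-- Let an optimal action for `M` face an optimal action for `M'`. -/
theorem value_le_add {M M' : I → J → ℝ} {c : ℝ} (h : ∀ i j, M i j ≤ M' i j + c) :
    value M ≤ value M' + c :=
  calc value M ≤ mixed (opt₁ M) (opt₂ M') M := value_le_mixed M _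
    _ ≤ mixed (opt₁ M) (opt₂ M') (fun i j => M' i j + c) := mixed_mono _ _ h
    _ = mixed (opt₁ M) (opt₂ M') M' + c := by rw [mixed_add, mixed_const]
    _ ≤ value M' + c := by gcongr; exact mixed_le_value M' _

theorem abs_value_sub_le {M M' : I → J → ℝ} {c : ℝ} (h : ∀ i j, |M i j - M' i j| ≤ c) :
    |value M - value M'| ≤ c := by
  have h₁ := value_le_add (M := M) (M' := M') (c := c) fun i j => by
    linarith [(abs_le.1 (h i j)).2]
  have h₂ := value_le_add (M := M') (M' := M) (c := c) fun i j => by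
    linarith [(abs_le.1 (h i j)).1]
  exact abs_le.2 ⟨by linarith, by linarith⟩

theorem value_smul {c : ℝ} (hc : 0 ≤ c) (M : I → J → ℝ) :
    value (fun i j => c * M i j) = c * value M := by
  apply le_antisymm
  · refine (value_le_mixed _ (opt₂ M)).trans ?_
    rw [mixed_smul]
    exact mul_le_mul_of_nonneg_left (mixed_le_value M _) hc
  · refine le_trans ?_ (mixed_le_value (fun i j => c * M i j) (opt₁ M))
    rw [mixed_smul]
    exact mul_le_mul_of_nonneg_left (value_le_mixed M _) hc

end MatrixGame

/-! ### Unnormalized beliefs and the dynamic programming recursion. -/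

namespace HiddenStochasticGame

variable {K I J A : Type*} [Fintype K] [Fintype A]

/-- The total mass `∑ k, |u k|` of an unnormalized belief. -/
def mass (u : K → ℝ) : ℝ := ∑ k, |u k|

theorem mass_nonneg (u : K → ℝ) : 0 ≤ mass u := Finset.sum_nonneg fun _ _ => abs_nonneg _

theorem mass_coe (p : stdSimplex ℝ K) : mass p.1 = 1 := by
  rw [← p.2.2]
  exact Finset.sum_congr rfl fun k _ => abs_of_nonneg (p.2.1 k)

/-- The unnormalized belief which follows `u` when `i`, `j` are played and `a` is announced. -/
def beliefStep (G : HiddenStochasticGame K I J A) (u : K → ℝ) (i : I) (j : J) (a : A) : K → ℝ :=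
  fun k' => ∑ k, u k * (G.transition k i j).1 (k', a)

/-- The stage payoff of the actions `i`, `j` under the unnormalized belief `u`. -/
def beliefPayoff (G : HiddenStochasticGame K I J A) (u : K → ℝ) (i : I) (j : J) : ℝ :=
  ∑ k, u k * G.payoff k i j

theorem beliefPayoff_sub (G : HiddenStochasticGame K I J A) (u u' : K → ℝ) (i : I) (j : J) :
    G.beliefPayoff (u - u') i j = G.beliefPayoff u i j - G.beliefPayoff u' i j := by
  simp [beliefPayoff, sub_mul]

theorem beliefPayoff_smul (G : HiddenStochasticGame K I J A) (c : ℝ) (u : K → ℝ) (i : I) (j : J) :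
    G.beliefPayoff (c • u) i j = c * G.beliefPayoff u i j := by
  simp [beliefPayoff, Finset.mul_sum, mul_assoc]

theorem beliefStep_sub (G : HiddenStochasticGame K I J A) (u u' : K → ℝ) (i : I) (j : J) (a : A) :
    G.beliefStep (u - u') i j a = G.beliefStep u i j a - G.beliefStep u' i j a := by
  ext; simp [beliefStep, sub_mul]

theorem beliefStep_smul (G : HiddenStochasticGame K I J A) (c : ℝ) (u : K → ℝ) (i : I) (j : J)
    (a : A) : G.beliefStep (c • u) i j a = c • G.beliefStep u i j a := by
  ext; simp [beliefStep, Finset.mul_sum, mul_assoc]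

theorem beliefStep_nonneg (G : HiddenStochasticGame K I J A) {u : K → ℝ} (hu : 0 ≤ u) (i : I)
    (j : J) (a : A) : 0 ≤ G.beliefStep u i j a := fun _ =>
  Finset.sum_nonneg fun k _ => mul_nonneg (hu k) ((G.transition k i j).2.1 _)

theorem sum_beliefStep (G : HiddenStochasticGame K I J A) (u : K → ℝ) (i : I) (j : J) :
    ∑ a, ∑ k', G.beliefStep u i j a k' = ∑ k, u k := by
  simp only [beliefStep]
  calc ∑ a, ∑ k', ∑ k, u k * (G.transition k i j).1 (k', a)
      = ∑ k', ∑ a, ∑ k, u k * (G.transition k i j).1 (k', a) := Finset.sum_comm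
    _ = ∑ z : K × A, ∑ k, u k * (G.transition k i j).1 z :=
        (Fintype.sum_prod_type' fun k' a => ∑ k, u k * (G.transition k i j).1 (k', a)).symm
    _ = ∑ k, ∑ z, u k * (G.transition k i j).1 z := Finset.sum_comm
    _ = ∑ k, u k := Finset.sum_congr rfl fun k _ => by
        rw [← Finset.mul_sum, (G.transition k i j).2.2, mul_one]

/-- A Markov kernel is nonexpansive in total variation; `u` may be signed, so this applies to
differences of beliefs. -/
theorem sum_mass_beliefStep_le (G : HiddenStochasticGame K I J A) (u : K → ℝ) (i : I) (j : J) :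
    ∑ a, mass (G.beliefStep u i j a) ≤ mass u := by
  rw [mass, ← G.sum_beliefStep (fun k => |u k|) i j]
  refine Finset.sum_le_sum fun a _ => Finset.sum_le_sum fun k' _ => ?_
  refine (Finset.abs_sum_le_sum_abs _ _).trans (Finset.sum_le_sum fun k _ => ?_)
  rw [abs_mul, abs_of_nonneg ((G.transition k i j).2.1 _)]

/-- Two beliefs are allowed so that one statement serves both for Lipschitz estimates and, with `u'
= 0`, for absolute bounds. -/
theorem abs_sum_beliefStep_le (G : HiddenStochasticGame K I J A) {F : (K → ℝ) → (K → ℝ) → ℝ}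
    {D : ℝ} (hD : 0 ≤ D) (u u' : K → ℝ) (i : I) (j : J)
    (h : ∀ a, |F (G.beliefStep u i j a) (G.beliefStep u' i j a)| ≤
      D * mass (G.beliefStep (u - u') i j a)) :
    |∑ a, F (G.beliefStep u i j a) (G.beliefStep u' i j a)| ≤ D * mass (u - u') :=
  calc _ ≤ ∑ a, D * mass (G.beliefStep (u - u') i j a) :=
        (Finset.abs_sum_le_sum_abs _ _).trans (Finset.sum_le_sum fun a _ => h a)
    _ ≤ D * mass (u - u') := by
        rw [← Finset.mul_sum]
        exact mul_le_mul_of_nonneg_left (G.sum_mass_beliefStep_le _ i j) hD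

variable [Fintype I] [Fintype J]

/-- A bound of the payoff function. -/
def payoffBound (G : HiddenStochasticGame K I J A) : ℝ := ∑ k, ∑ i, ∑ j, |G.payoff k i j|

theorem payoffBound_nonneg (G : HiddenStochasticGame K I J A) : 0 ≤ G.payoffBound :=
  Finset.sum_nonneg fun _ _ => Finset.sum_nonneg fun _ _ => Finset.sum_nonneg fun _ _ =>
    abs_nonneg _

theorem abs_payoff_le (G : HiddenStochasticGame K I J A) (k : K) (i : I) (j : J) :
    |G.payoff k i j| ≤ G.payoffBound :=
  calc |G.payoff k i j| ≤ ∑ j, |G.payoff k i j| :=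
        Finset.single_le_sum (f := fun j => |G.payoff k i j|) (fun _ _ => abs_nonneg _)
          (Finset.mem_univ j)
    _ ≤ ∑ i, ∑ j, |G.payoff k i j| :=
        Finset.single_le_sum (f := fun i => ∑ j, |G.payoff k i j|)
          (fun _ _ => Finset.sum_nonneg fun _ _ => abs_nonneg _) (Finset.mem_univ i)
    _ ≤ _ := Finset.single_le_sum (f := fun k => ∑ i, ∑ j, |G.payoff k i j|)
          (fun _ _ => Finset.sum_nonneg fun _ _ => Finset.sum_nonneg fun _ _ => abs_nonneg _)
          (Finset.mem_univ k)

theorem abs_beliefPayoff_le (G : HiddenStochasticGame K I J A) (u : K → ℝ) (i : I) (j : J) :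
    |G.beliefPayoff u i j| ≤ G.payoffBound * mass u := by
  rw [mass, Finset.mul_sum]
  refine (Finset.abs_sum_le_sum_abs _ _).trans (Finset.sum_le_sum fun k _ => ?_)
  rw [abs_mul, mul_comm]
  exact mul_le_mul_of_nonneg_right (G.abs_payoff_le k i j) (abs_nonneg _)

variable [Nonempty I] [Nonempty J]

/-- The dynamic programming value of the game with `N` stages in which stage `m + 1` has weight
`w m`, as a function of the unnormalized initial belief. -/
noncomputable def finiteValue (G : HiddenStochasticGame K I J A) :
    (ℕ → ℝ) → ℕ → (K → ℝ) → ℝ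
  | _, 0, _ => 0
  | w, N + 1, u => MatrixGame.value fun i j => w 0 * G.beliefPayoff u i j +
      ∑ a, G.finiteValue (fun m => w (m + 1)) N (G.beliefStep u i j a)

/-- Homogeneity is why beliefs need no normalization: the probability of a signal is absorbed in the
mass of the next belief, and no conditioning occurs. -/
theorem finiteValue_smul (G : HiddenStochasticGame K I J A) {c : ℝ} (hc : 0 ≤ c) (N : ℕ) :
    ∀ (w : ℕ → ℝ) (u : K → ℝ), G.finiteValue w N (c • u) = c * G.finiteValue w N u := by
  induction N with
  | zero => intro w u; simp [finiteValue]
  | succ N ih =>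
    intro w u
    simp only [finiteValue, beliefStep_smul, beliefPayoff_smul, ih]
    rw [← MatrixGame.value_smul hc]
    congr 1; ext i j
    rw [mul_add, Finset.mul_sum]; ring

theorem finiteValue_weight_smul (G : HiddenStochasticGame K I J A) {c : ℝ} (hc : 0 ≤ c) (N : ℕ) :
    ∀ (w : ℕ → ℝ) (u : K → ℝ),
      G.finiteValue (fun m => c * w m) N u = c * G.finiteValue w N u := by
  induction N with
  | zero => intro w u; simp [finiteValue]
  | succ N ih =>
    intro w u
    simp only [finiteValue]
    rw [← MatrixGame.value_smul hc]
    congr 1; ext i j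
    rw [mul_add, Finset.mul_sum]
    simp only [ih (fun m => w (m + 1))]
    ring

/-- The matrix value is nonexpansive and one transition does not increase the mass of `u - u'`, so
only the weighted stage payoffs contribute to the constant. -/
theorem abs_finiteValue_sub_le (G : HiddenStochasticGame K I J A) (N : ℕ) :
    ∀ (w : ℕ → ℝ) (u u' : K → ℝ), |G.finiteValue w N u - G.finiteValue w N u'| ≤
      (G.payoffBound * ∑ m ∈ Finset.range N, |w m|) * mass (u - u') := by
  induction N with
  | zero => intro w u u'; simp [finiteValue]
  | succ N ih =>
    intro w u u'
    simp only [finiteValue]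
    refine MatrixGame.abs_value_sub_le fun i j => ?_
    have h₁ := G.abs_sum_beliefStep_le
      (F := fun u u' => G.finiteValue (fun m => w (m + 1)) N u -
        G.finiteValue (fun m => w (m + 1)) N u')
      (mul_nonneg G.payoffBound_nonneg (Finset.sum_nonneg fun m _ => abs_nonneg (w (m + 1))))
      u u' i j (fun a => by rw [beliefStep_sub]; exact ih _ _ _)
    rw [Finset.sum_sub_distrib] at h₁
    have h₂ : |w 0 * G.beliefPayoff (u - u') i j| ≤ |w 0| * (G.payoffBound * mass (u - u')) := by
      rw [abs_mul]
      exact mul_le_mul_of_nonneg_left (G.abs_beliefPayoff_le _ i j) (abs_nonneg _)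
    rw [beliefPayoff_sub] at h₂
    rw [Finset.sum_range_succ']
    calc _ = |w 0 * (G.beliefPayoff u i j - G.beliefPayoff u' i j) +
          (∑ a, G.finiteValue (fun m => w (m + 1)) N (G.beliefStep u i j a) -
            ∑ a, G.finiteValue (fun m => w (m + 1)) N (G.beliefStep u' i j a))| := by
          congr 1; ring
      _ ≤ _ := (abs_add_le _ _).trans (add_le_add h₂ h₁)
      _ = _ := by ring

theorem abs_finiteValue_le (G : HiddenStochasticGame K I J A) (w : ℕ → ℝ) (N : ℕ) (u : K → ℝ) :
    |G.finiteValue w N u| ≤ (G.payoffBound * ∑ m ∈ Finset.range N, |w m|) * mass u := by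
  have h := G.abs_finiteValue_sub_le N w u 0
  have h0 : G.finiteValue w N 0 = 0 := by
    have := G.finiteValue_smul le_rfl N w 0
    simpa using this
  simpa [h0] using h

/-! ### Discounted weights, and comparison of the two recursions. -/

/-- The weights of the stages in the discounted game. -/
def discount (lam : ℝ) (m : ℕ) : ℝ := lam * (1 - lam) ^ m

theorem discount_nonneg {lam : ℝ} (h₀ : 0 < lam) (h₁ : lam ≤ 1) (m : ℕ) : 0 ≤ discount lam m :=
  mul_nonneg h₀.le (pow_nonneg (by linarith) m)

theorem hasSum_discount {lam : ℝ} (h₀ : 0 < lam) (h₁ : lam ≤ 1) : HasSum (discount lam) 1 := by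
  have := (hasSum_geometric_of_lt_one (r := 1 - lam) (by linarith) (by linarith)).mul_left lam
  rwa [sub_sub_cancel, mul_inv_cancel₀ h₀.ne'] at this

theorem sum_abs_discount_le {lam : ℝ} (h₀ : 0 < lam) (h₁ : lam ≤ 1) (N : ℕ) :
    ∑ m ∈ Finset.range N, |discount lam m| ≤ 1 := by
  simp_rw [abs_of_nonneg (discount_nonneg h₀ h₁ _)]
  exact sum_le_hasSum _ (fun m _ => discount_nonneg h₀ h₁ m) (hasSum_discount h₀ h₁)

theorem abs_finiteValue_discount_le (G : HiddenStochasticGame K I J A) {lam : ℝ} (h₀ : 0 < lam)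
    (h₁ : lam ≤ 1) (N : ℕ) (u : K → ℝ) :
    |G.finiteValue (discount lam) N u| ≤ G.payoffBound * mass u := by
  refine (G.abs_finiteValue_le _ N u).trans ?_
  refine mul_le_mul_of_nonneg_right ?_ (mass_nonneg u)
  exact mul_le_of_le_one_right G.payoffBound_nonneg (sum_abs_discount_le h₀ h₁ N)

/-- Comparison of the total-payoff operator with the discounted operator, in one step. -/
theorem abs_finiteValue_succ_sub_discount_le (G : HiddenStochasticGame K I J A) {lam D : ℝ}
    (h₀ : 0 < lam) (h₁ : lam ≤ 1) (hD : 0 ≤ D) (m N : ℕ)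
    (h : ∀ u : K → ℝ, 0 ≤ u →
      |G.finiteValue (fun _ => 1) m u - m * G.finiteValue (discount lam) N u| ≤ D * mass u)
    (u : K → ℝ) (hu : 0 ≤ u) :
    |G.finiteValue (fun _ => 1) (m + 1) u -
        (m + 1 : ℕ) * G.finiteValue (discount lam) (N + 1) u| ≤
      (D + 2 * G.payoffBound * |1 - (m + 1 : ℕ) * lam|) * mass u := by
  -- After one stage the discounted game is itself again, scaled by 1 - λ.
  have hshift : (fun l => discount lam (l + 1)) = fun l => (1 - lam) * discount lam l := by
    ext l; simp only [discount]; ring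
  simp only [finiteValue, hshift]
  rw [← MatrixGame.value_smul (Nat.cast_nonneg (m + 1))]
  refine MatrixGame.abs_value_sub_le fun i j => ?_
  simp only [G.finiteValue_weight_smul (sub_nonneg.2 h₁)]
  set e : ℝ := 1 - (m + 1 : ℕ) * lam with he
  have b₁ := G.abs_beliefPayoff_le u i j
  have b₂ : |∑ a, (G.finiteValue (fun _ => 1) m (G.beliefStep u i j a) -
      m * G.finiteValue (discount lam) N (G.beliefStep u i j a))| ≤ D * mass u := by
    have := G.abs_sum_beliefStep_le (F := fun u _ => G.finiteValue (fun _ => 1) m u -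
      m * G.finiteValue (discount lam) N u) hD u 0 i j
      (fun a => by simpa using h _ (G.beliefStep_nonneg hu i j a))
    simpa using this
  have b₃ : |∑ a, G.finiteValue (discount lam) N (G.beliefStep u i j a)| ≤
      G.payoffBound * mass u := by
    have := G.abs_sum_beliefStep_le (F := fun u _ => G.finiteValue (discount lam) N u)
      G.payoffBound_nonneg u 0 i j
      (fun a => by simpa using G.abs_finiteValue_discount_le h₀ h₁ N (G.beliefStep u i j a))
    simpa using this
  -- The two leftover coefficients are opposite, since m - (m + 1)(1 - λ) = -(1 - (m + 1)λ); each is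
  -- paired with a quantity bounded by C times the mass.
  have key : (1 * G.beliefPayoff u i j + ∑ a, G.finiteValue (fun _ => 1) m (G.beliefStep u i j a)) -
      (m + 1 : ℕ) * (discount lam 0 * G.beliefPayoff u i j +
        ∑ a, (1 - lam) * G.finiteValue (discount lam) N (G.beliefStep u i j a)) =
      e * G.beliefPayoff u i j + (∑ a, (G.finiteValue (fun _ => 1) m (G.beliefStep u i j a) -
      m * G.finiteValue (discount lam) N (G.beliefStep u i j a))) +
      (-e) * ∑ a, G.finiteValue (discount lam) N (G.beliefStep u i j a) := by
    rw [Finset.sum_sub_distrib, ← Finset.mul_sum, ← Finset.mul_sum, he, discount]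
    push_cast; ring
  rw [key]
  refine (abs_add_three _ _ _).trans ?_
  rw [abs_mul, abs_mul, abs_neg]
  have := mul_le_mul_of_nonneg_left b₁ (abs_nonneg e)
  have := mul_le_mul_of_nonneg_left b₃ (abs_nonneg e)
  linarith

theorem abs_finiteValue_add_sub_discount_le (G : HiddenStochasticGame K I J A) {lam D e : ℝ}
    (h₀ : 0 < lam) (h₁ : lam ≤ 1) (hD : 0 ≤ D) (he : 0 ≤ e) (n N : ℕ)
    (h : ∀ u : K → ℝ, 0 ≤ u →
      |G.finiteValue (fun _ => 1) n u - n * G.finiteValue (discount lam) N u| ≤ D * mass u)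
    (r : ℕ) (hr : ∀ m, n < m → m ≤ n + r → |1 - (m : ℝ) * lam| ≤ e) :
    ∀ u : K → ℝ, 0 ≤ u →
      |G.finiteValue (fun _ => 1) (n + r) u -
          (n + r : ℕ) * G.finiteValue (discount lam) (N + r) u| ≤
        (D + r * (2 * G.payoffBound * e)) * mass u := by
  have hC := G.payoffBound_nonneg
  induction r with
  | zero => simpa using h
  | succ r ih =>
    intro u hu
    refine (G.abs_finiteValue_succ_sub_discount_le h₀ h₁ (by positivity) (n + r) (N + r)
      (ih fun m hm hm' => hr m hm (by omega)) u hu).trans ?_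
    refine mul_le_mul_of_nonneg_right ?_ (mass_nonneg u)
    have := mul_le_mul_of_nonneg_left (hr (n + r + 1) (by omega) (by omega))
      (mul_nonneg zero_le_two hC)
    push_cast at this ⊢
    linarith

end HiddenStochasticGame

/-! ### Laws of public histories, and optimal strategies. -/

namespace HiddenStochasticGame

variable {K I J A : Type*}

section

variable [Fintype I] [Fintype J]

/-- The contribution of the strategies to the probability of a public history. -/
def playWeight (σ : Strategy₁ I J A) (τ : Strategy₂ I J A) : History I J A → ℝ
  | [] => 1
  | (i, j, _) :: h => playWeight σ τ h * ((σ h).1 i * (τ h).1 j)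

theorem playWeight_nonneg (σ : Strategy₁ I J A) (τ : Strategy₂ I J A) (h : History I J A) :
    0 ≤ playWeight σ τ h := by
  induction h with
  | nil => exact zero_le_one
  | cons x h ih => exact mul_nonneg ih (mul_nonneg ((σ h).2.1 _) ((τ h).2.1 _))

end

variable [Fintype K] [Fintype A]

/-- The unnormalized belief after a public history. -/
def belief (G : HiddenStochasticGame K I J A) (p : K → ℝ) : History I J A → K → ℝ
  | [] => p
  | (i, j, a) :: h => G.beliefStep (G.belief p h) i j a

theorem belief_nonneg (G : HiddenStochasticGame K I J A) (p : stdSimplex ℝ K)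
    (h : History I J A) : 0 ≤ G.belief p.1 h := by
  induction h with
  | nil => exact p.2.1
  | cons x h ih => exact G.beliefStep_nonneg ih _ _ _

variable [Fintype I] [Fintype J]

/-- The strategies depend on the public history only, so they factor out and leave a belief
independent of them. -/
theorem prob_eq (G : HiddenStochasticGame K I J A) (p : stdSimplex ℝ K) (σ : Strategy₁ I J A)
    (τ : Strategy₂ I J A) (h : History I J A) (k : K) :
    G.prob p σ τ h k = playWeight σ τ h * G.belief p.1 h k := by
  induction h generalizing k with
  | nil => simp [prob, playWeight, belief]
  | cons x h ih =>
    simp only [prob, playWeight, belief, beliefStep, ih, Finset.mul_sum]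
    exact Finset.sum_congr rfl fun k _ => by ring

/-- The sum of `f` over the public histories of length `m`, weighted by `playWeight`. -/
def expect (σ : Strategy₁ I J A) (τ : Strategy₂ I J A) (m : ℕ) (f : History I J A → ℝ) : ℝ :=
  ∑ h : List.Vector (I × J × A) m, playWeight σ τ h.toList * f h.toList

theorem expect_zero (σ : Strategy₁ I J A) (τ : Strategy₂ I J A) (f : History I J A → ℝ) :
    expect σ τ 0 f = f [] := by
  rw [expect, Fintype.sum_eq_single List.Vector.nil fun x hx => (hx (Subsingleton.elim _ _)).elim]
  simp [playWeight]

theorem sum_vector_succ {α : Type*} [Fintype α] (m : ℕ) (f : List α → ℝ) :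
    ∑ h : List.Vector α (m + 1), f h.toList = ∑ h : List.Vector α m, ∑ x, f (x :: h.toList) := by
  rw [← Fintype.sum_prod_type']
  refine Fintype.sum_equiv
    ⟨fun h => (h.tail, h.head), fun z => z.2 ::ᵥ z.1, fun h => by simp, fun z => by simp⟩ _ _
    fun h => ?_
  conv_lhs => rw [← List.Vector.cons_head_tail h]
  rw [List.Vector.toList_cons]
  rfl

theorem expect_succ (σ : Strategy₁ I J A) (τ : Strategy₂ I J A) (m : ℕ)
    (f : History I J A → ℝ) : expect σ τ (m + 1) f =
      expect σ τ m fun h => MatrixGame.mixed (σ h) (τ h) fun i j => ∑ a, f ((i, j, a) :: h) := by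
  simp only [expect]
  rw [sum_vector_succ m fun h => playWeight σ τ h * f h]
  refine Finset.sum_congr rfl fun h _ => ?_
  simp only [Fintype.sum_prod_type, MatrixGame.mixed, Finset.mul_sum, playWeight]
  exact Finset.sum_congr rfl fun i _ => Finset.sum_congr rfl fun j _ =>
    Finset.sum_congr rfl fun a _ => by ring

theorem expect_add (σ : Strategy₁ I J A) (τ : Strategy₂ I J A) (m : ℕ)
    (f g : History I J A → ℝ) :
    expect σ τ m (fun h => f h + g h) = expect σ τ m f + expect σ τ m g := by
  simp only [expect, mul_add, Finset.sum_add_distrib]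

theorem expect_smul (σ : Strategy₁ I J A) (τ : Strategy₂ I J A) (m : ℕ) (c : ℝ)
    (f : History I J A → ℝ) : expect σ τ m (fun h => c * f h) = c * expect σ τ m f := by
  simp only [expect, Finset.mul_sum]
  exact Finset.sum_congr rfl fun h _ => by ring

theorem expect_mono (σ : Strategy₁ I J A) (τ : Strategy₂ I J A) (m : ℕ)
    {f g : History I J A → ℝ} (hfg : ∀ h, h.length = m → f h ≤ g h) :
    expect σ τ m f ≤ expect σ τ m g :=
  Finset.sum_le_sum fun h _ =>
    mul_le_mul_of_nonneg_left (hfg _ h.toList_length) (playWeight_nonneg σ τ _)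

theorem stagePayoff_eq (G : HiddenStochasticGame K I J A) (p : stdSimplex ℝ K)
    (σ : Strategy₁ I J A) (τ : Strategy₂ I J A) (m : ℕ) :
    G.stagePayoff p σ τ m = expect σ τ m fun h =>
      MatrixGame.mixed (σ h) (τ h) (G.beliefPayoff (G.belief p.1 h)) := by
  simp only [stagePayoff, expect]
  refine Finset.sum_congr rfl fun h _ => ?_
  simp only [MatrixGame.mixed, beliefPayoff, prob_eq, Finset.mul_sum]
  rw [Finset.sum_comm]
  refine Finset.sum_congr rfl fun i _ => ?_
  rw [Finset.sum_comm]
  exact Finset.sum_congr rfl fun j _ => Finset.sum_congr rfl fun k _ => by ring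

/-- `playWeight` alone ignores the law of the signals; only its product with the mass of the belief
is a probability on histories. -/
theorem expect_belief (G : HiddenStochasticGame K I J A) (p : stdSimplex ℝ K)
    (σ : Strategy₁ I J A) (τ : Strategy₂ I J A) (m : ℕ) :
    expect σ τ m (fun h => ∑ k, G.belief p.1 h k) = 1 := by
  induction m with
  | zero => rw [expect_zero]; exact p.2.2
  | succ m ih =>
    rw [expect_succ, ← ih]
    simp only [belief, sum_beliefStep, MatrixGame.mixed_const]

theorem abs_stagePayoff_le (G : HiddenStochasticGame K I J A) (p : stdSimplex ℝ K)
    (σ : Strategy₁ I J A) (τ : Strategy₂ I J A) (m : ℕ) :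
    |G.stagePayoff p σ τ m| ≤ G.payoffBound := by
  have hb : ∀ h i j, |G.beliefPayoff (G.belief p.1 h) i j| ≤
      G.payoffBound * ∑ k, G.belief p.1 h k := fun h i j => by
    refine (G.abs_beliefPayoff_le _ i j).trans_eq ?_
    rw [mass]
    congr 1
    exact Finset.sum_congr rfl fun k _ => abs_of_nonneg (G.belief_nonneg p h k)
  have hup : ∀ c : ℝ, expect σ τ m (fun h => c * ∑ k, G.belief p.1 h k) = c := fun c => by
    rw [expect_smul, expect_belief, mul_one]
  rw [stagePayoff_eq, abs_le]
  constructor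
  · rw [← hup (-G.payoffBound)]
    refine expect_mono σ τ m fun h _ => ?_
    rw [← MatrixGame.mixed_const (σ h) (τ h) (-G.payoffBound * _)]
    exact MatrixGame.mixed_mono _ _ fun i j => by linarith [(abs_le.1 (hb h i j)).1]
  · conv_rhs => rw [← hup G.payoffBound]
    refine expect_mono σ τ m fun h _ => ?_
    rw [← MatrixGame.mixed_const (σ h) (τ h) (G.payoffBound * _)]
    exact MatrixGame.mixed_mono _ _ fun i j => (abs_le.1 (hb h i j)).2

/-- The matrix game after the history `h`, when stage `m + 1` has weight `w m` and the continuation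
payoff is `R`. -/
def stageMatrix (G : HiddenStochasticGame K I J A) (p : K → ℝ) (w : ℕ → ℝ)
    (R : History I J A → ℝ) (h : History I J A) (i : I) (j : J) : ℝ :=
  w h.length * G.beliefPayoff (G.belief p h) i j + ∑ a, R ((i, j, a) :: h)

theorem weightedPayoff_succ (G : HiddenStochasticGame K I J A) (p : stdSimplex ℝ K)
    (σ : Strategy₁ I J A) (τ : Strategy₂ I J A) (w : ℕ → ℝ) (R : History I J A → ℝ) (m : ℕ) :
    w m * G.stagePayoff p σ τ m + expect σ τ (m + 1) R =
      expect σ τ m fun h => MatrixGame.mixed (σ h) (τ h) (G.stageMatrix p.1 w R h) := by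
  rw [stagePayoff_eq, expect_succ, ← expect_smul, ← expect_add]
  refine Finset.sum_congr rfl fun h _ => ?_
  have e : G.stageMatrix p.1 w R h.toList = fun i j =>
      w m * G.beliefPayoff (G.belief p.1 h.toList) i j + ∑ a, R ((i, j, a) :: h.toList) := by
    ext i j; rw [stageMatrix, h.toList_length]
  beta_reduce
  rw [e, MatrixGame.mixed_add, MatrixGame.mixed_smul]

/-- A submartingale argument: the accumulated payoff plus the expected continuation `R` cannot
decrease from one stage to the next. -/
theorem le_weightedPayoff (G : HiddenStochasticGame K I J A) (p : stdSimplex ℝ K)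
    (σ : Strategy₁ I J A) (τ : Strategy₂ I J A) (w : ℕ → ℝ) (R : History I J A → ℝ) (N : ℕ)
    (hR : ∀ h, h.length < N → R h ≤ MatrixGame.mixed (σ h) (τ h) (G.stageMatrix p.1 w R h)) :
    R [] ≤ ∑ m ∈ Finset.range N, w m * G.stagePayoff p σ τ m + expect σ τ N R := by
  induction N with
  | zero => simp [expect_zero]
  | succ N ih =>
    refine (ih fun h hh => hR h (by omega)).trans ?_
    rw [Finset.sum_range_succ, add_assoc, weightedPayoff_succ]
    gcongr
    exact expect_mono σ τ N fun h hh => hR h (by omega)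

theorem weightedPayoff_le (G : HiddenStochasticGame K I J A) (p : stdSimplex ℝ K)
    (σ : Strategy₁ I J A) (τ : Strategy₂ I J A) (w : ℕ → ℝ) (R : History I J A → ℝ) (N : ℕ)
    (hR : ∀ h, h.length < N → MatrixGame.mixed (σ h) (τ h) (G.stageMatrix p.1 w R h) ≤ R h) :
    ∑ m ∈ Finset.range N, w m * G.stagePayoff p σ τ m + expect σ τ N R ≤ R [] := by
  induction N with
  | zero => simp [expect_zero]
  | succ N ih =>
    refine le_trans ?_ (ih fun h hh => hR h (by omega))
    rw [Finset.sum_range_succ, add_assoc, weightedPayoff_succ]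
    gcongr
    exact expect_mono σ τ N fun h hh => hR h (by omega)

theorem abs_nStagePayoff_le (G : HiddenStochasticGame K I J A) (n : ℕ) (p : stdSimplex ℝ K)
    (σ : Strategy₁ I J A) (τ : Strategy₂ I J A) : |G.nStagePayoff n p σ τ| ≤ G.payoffBound := by
  rcases Nat.eq_zero_or_pos n with rfl | hn
  · simpa [nStagePayoff] using G.payoffBound_nonneg
  · have hn' : (0 : ℝ) < n := by exact_mod_cast hn
    rw [nStagePayoff, abs_mul, abs_of_pos (inv_pos.2 hn'), inv_mul_le_iff₀ hn']
    refine (Finset.abs_sum_le_sum_abs _ _).trans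
      ((Finset.sum_le_sum fun m _ => G.abs_stagePayoff_le p σ τ m).trans_eq ?_)
    simp

theorem summable_discount_stagePayoff (G : HiddenStochasticGame K I J A) {lam : ℝ} (h₀ : 0 < lam)
    (h₁ : lam ≤ 1) (p : stdSimplex ℝ K) (σ : Strategy₁ I J A) (τ : Strategy₂ I J A) :
    Summable fun m => discount lam m * G.stagePayoff p σ τ m := by
  refine Summable.of_norm_bounded ((hasSum_discount h₀ h₁).summable.mul_right G.payoffBound)
    fun m => ?_
  rw [Real.norm_eq_abs, abs_mul, abs_of_nonneg (discount_nonneg h₀ h₁ m)]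
  exact mul_le_mul_of_nonneg_left (G.abs_stagePayoff_le p σ τ m) (discount_nonneg h₀ h₁ m)

theorem abs_discountedPayoff_sub_le (G : HiddenStochasticGame K I J A) {lam : ℝ} (h₀ : 0 < lam)
    (h₁ : lam ≤ 1) (p : stdSimplex ℝ K) (σ : Strategy₁ I J A) (τ : Strategy₂ I J A) (N : ℕ) :
    |G.discountedPayoff lam p σ τ -
        ∑ m ∈ Finset.range N, discount lam m * G.stagePayoff p σ τ m| ≤
      (1 - lam) ^ N * G.payoffBound := by
  have hs := G.summable_discount_stagePayoff h₀ h₁ p σ τ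
  have e : G.discountedPayoff lam p σ τ = ∑' m, discount lam m * G.stagePayoff p σ τ m := rfl
  rw [e, ← hs.sum_add_tsum_nat_add N, add_sub_cancel_left, ← Real.norm_eq_abs]
  have hd : HasSum (fun m => discount lam (m + N) * G.payoffBound)
      ((1 - lam) ^ N * G.payoffBound) := by
    have := ((hasSum_discount h₀ h₁).mul_left ((1 - lam) ^ N)).mul_right G.payoffBound
    rw [mul_one] at this
    refine this.congr_fun fun m => ?_
    simp only [discount, pow_add]; ring
  refine tsum_of_norm_bounded hd fun m => ?_
  rw [Real.norm_eq_abs, abs_mul, abs_of_nonneg (discount_nonneg h₀ h₁ _)]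
  exact mul_le_mul_of_nonneg_left (G.abs_stagePayoff_le p σ τ _) (discount_nonneg h₀ h₁ _)

theorem abs_discountedPayoff_le (G : HiddenStochasticGame K I J A) {lam : ℝ} (h₀ : 0 < lam)
    (h₁ : lam ≤ 1) (p : stdSimplex ℝ K) (σ : Strategy₁ I J A) (τ : Strategy₂ I J A) :
    |G.discountedPayoff lam p σ τ| ≤ G.payoffBound := by
  simpa using G.abs_discountedPayoff_sub_le h₀ h₁ p σ τ 0

theorem tendsto_pow_mul_payoffBound (G : HiddenStochasticGame K I J A) {lam : ℝ} (h₀ : 0 < lam)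
    (h₁ : lam ≤ 1) : Tendsto (fun N => (1 - lam) ^ N * G.payoffBound) atTop (𝓝 0) := by
  simpa using (tendsto_pow_atTop_nhds_zero_of_lt_one (r := 1 - lam) (by linarith)
    (by linarith)).mul_const G.payoffBound

variable [Nonempty I] [Nonempty J]

/-- Both players can guarantee `finiteValue` in the weighted game with finitely many stages. -/
theorem exists_optimal_strategies (G : HiddenStochasticGame K I J A) (p : stdSimplex ℝ K)
    (w : ℕ → ℝ) (N : ℕ) : ∃ (σ₀ : Strategy₁ I J A) (τ₀ : Strategy₂ I J A),
      (∀ τ, G.finiteValue w N p.1 ≤ ∑ m ∈ Finset.range N, w m * G.stagePayoff p σ₀ τ m) ∧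
      ∀ σ, ∑ m ∈ Finset.range N, w m * G.stagePayoff p σ τ₀ m ≤ G.finiteValue w N p.1 := by
  -- The value of the remaining game, with weights shifted by the elapsed time. The truncated
  -- subtraction makes it zero from length `N` on.
  let R : History I J A → ℝ := fun h =>
    G.finiteValue (fun l => w (l + h.length)) (N - h.length) (G.belief p.1 h)
  have hR₀ : R [] = G.finiteValue w N p.1 := by simp [R, belief]
  have hR : ∀ h, h.length < N → R h = MatrixGame.value (G.stageMatrix p.1 w R h) := by
    intro h hh
    have e : N - h.length = N - (h.length + 1) + 1 := by omega
    simp only [R]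
    rw [e, finiteValue]
    congr 1; ext i j
    simp only [stageMatrix, List.length_cons, belief, zero_add, add_assoc, add_comm 1]
  have hN : ∀ σ τ, expect σ τ N R = 0 := fun σ τ =>
    Finset.sum_eq_zero fun h _ => by simp [R, finiteValue]
  refine ⟨fun h => MatrixGame.opt₁ (G.stageMatrix p.1 w R h),
    fun h => MatrixGame.opt₂ (G.stageMatrix p.1 w R h), fun τ => ?_, fun σ => ?_⟩
  · have := G.le_weightedPayoff p _ τ w R N fun h hh =>
      (hR h hh).trans_le (MatrixGame.value_le_mixed _ (τ h))
    rwa [hR₀, hN, add_zero] at this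
  · have := G.weightedPayoff_le p σ _ w R N fun h hh =>
      (MatrixGame.mixed_le_value _ (σ h)).trans_eq (hR h hh).symm
    rwa [hR₀, hN, add_zero] at this

theorem nStage_value (G : HiddenStochasticGame K I J A) (n : ℕ) (p : stdSimplex ℝ K) :
    lowerValue (G.nStagePayoff n p) = (n : ℝ)⁻¹ * G.finiteValue (fun _ => 1) n p.1 ∧
      lowerValue (G.nStagePayoff n p) = upperValue (G.nStagePayoff n p) := by
  obtain ⟨σ₀, τ₀, h₁, h₂⟩ := G.exists_optimal_strategies p (fun _ => 1) n
  simp only [one_mul] at h₁ h₂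
  have hn : 0 ≤ (n : ℝ)⁻¹ := by positivity
  obtain ⟨a, b, c⟩ := value_bounds (γ := G.nStagePayoff n p) (ε := 0)
    (v := (n : ℝ)⁻¹ * G.finiteValue (fun _ => 1) n p.1)
    (G.abs_nStagePayoff_le n p) σ₀ τ₀
    (fun τ => by rw [sub_zero]; exact mul_le_mul_of_nonneg_left (h₁ τ) hn)
    (fun σ => by rw [add_zero]; exact mul_le_mul_of_nonneg_left (h₂ σ) hn)
  exact ⟨by linarith, by linarith⟩

theorem discounted_value_bounds (G : HiddenStochasticGame K I J A) {lam : ℝ} (h₀ : 0 < lam)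
    (h₁ : lam ≤ 1) (p : stdSimplex ℝ K) (N : ℕ) :
    G.finiteValue (discount lam) N p.1 - (1 - lam) ^ N * G.payoffBound ≤
        lowerValue (G.discountedPayoff lam p) ∧
      lowerValue (G.discountedPayoff lam p) ≤ upperValue (G.discountedPayoff lam p) ∧
      upperValue (G.discountedPayoff lam p) ≤
        G.finiteValue (discount lam) N p.1 + (1 - lam) ^ N * G.payoffBound := by
  obtain ⟨σ₀, τ₀, g₁, g₂⟩ := G.exists_optimal_strategies p (discount lam) N
  refine value_bounds (G.abs_discountedPayoff_le h₀ h₁ p) σ₀ τ₀ (fun τ => ?_) (fun σ => ?_)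
  · linarith [g₁ τ, (abs_le.1 (G.abs_discountedPayoff_sub_le h₀ h₁ p σ₀ τ N)).1]
  · linarith [g₂ σ, (abs_le.1 (G.abs_discountedPayoff_sub_le h₀ h₁ p σ τ₀ N)).2]

theorem tendsto_finiteValue_discount (G : HiddenStochasticGame K I J A) {lam : ℝ} (h₀ : 0 < lam)
    (h₁ : lam ≤ 1) (p : stdSimplex ℝ K) :
    Tendsto (fun N => G.finiteValue (discount lam) N p.1) atTop
      (𝓝 (G.discountedValue lam p)) := by
  have h := G.tendsto_pow_mul_payoffBound h₀ h₁
  refine tendsto_iff_norm_sub_tendsto_zero.2 (squeeze_zero (fun _ => norm_nonneg _) (fun N => ?_) h)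
  obtain ⟨a, b, c⟩ := G.discounted_value_bounds h₀ h₁ p N
  rw [Real.norm_eq_abs, discountedValue]
  exact abs_le.2 ⟨by linarith, by linarith⟩

theorem discounted_lowerValue_eq_upperValue (G : HiddenStochasticGame K I J A) {lam : ℝ}
    (h₀ : 0 < lam) (h₁ : lam ≤ 1) (p : stdSimplex ℝ K) :
    lowerValue (G.discountedPayoff lam p) = upperValue (G.discountedPayoff lam p) := by
  refine le_antisymm (G.discounted_value_bounds h₀ h₁ p 0).2.1 ?_
  have h := ((G.tendsto_pow_mul_payoffBound h₀ h₁).const_mul 2).const_add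
    (lowerValue (G.discountedPayoff lam p))
  rw [mul_zero, add_zero] at h
  refine ge_of_tendsto' h fun N => ?_
  obtain ⟨a, b, c⟩ := G.discounted_value_bounds h₀ h₁ p N
  linarith

end HiddenStochasticGame

/-! ### The Tauberian argument, for abstract families of functions. -/

section Tauberian

variable {X : Type*}

/-- Iterating D ↦ ρD + η from `B` approaches the fixed point η / (1 - ρ), which is below `s`;
finitely many iterations suffice. Eventual bounds are used because the bound at n will come from a
smaller index. -/
theorem eventually_forall_abs_le_of_contraction {ι : Type*} {l : Filter ι} {g : ι → X → ℝ}
    {B ρ η s : ℝ} (hB₀ : 0 ≤ B) (hρ₀ : 0 ≤ ρ) (hρ₁ : ρ < 1) (hη : 0 ≤ η)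
    (hB : ∀ᶠ i in l, ∀ x, |g i x| ≤ B)
    (hg : ∀ D, 0 ≤ D → (∀ᶠ i in l, ∀ x, |g i x| ≤ D) → ∀ᶠ i in l, ∀ x, |g i x| ≤ ρ * D + η)
    (hs : η < (1 - ρ) * s) : ∀ᶠ i in l, ∀ x, |g i x| ≤ s := by
  have h1ρ : 0 < 1 - ρ := by linarith
  set t := η / (1 - ρ) with ht
  have ht₀ : 0 ≤ t := by positivity
  have hts : t < s := by rw [ht, div_lt_iff₀ h1ρ]; linarith
  have hη' : η = (1 - ρ) * t := by rw [ht]; field_simp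
  have hk : ∀ k : ℕ, ∀ᶠ i in l, ∀ x, |g i x| ≤ ρ ^ k * B + t := by
    intro k
    induction k with
    | zero => filter_upwards [hB] with i hi x; simpa using (hi x).trans (by linarith)
    | succ k ih =>
      filter_upwards [hg _ (by positivity) ih] with i hi x
      refine (hi x).trans_eq ?_
      rw [hη']; ring
  have hlim : Tendsto (fun k => ρ ^ k * B + t) atTop (𝓝 t) := by
    simpa using ((tendsto_pow_atTop_nhds_zero_of_lt_one hρ₀ hρ₁).mul_const B).add_const t
  obtain ⟨k, hk'⟩ := (hlim.eventually (gt_mem_nhds hts)).exists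
  filter_upwards [hk k] with i hi x using (hi x).trans hk'.le

/-- The comparison inequality between a sequence `a n` and a family `b lam` from which the
Tauberian theorem follows: passing from `n - n / q` to `n` contracts the distance to
`b lam`, where `lam` is about `1 / n`, up to an error of order `1 / q ^ 2`. -/
def BlockContraction (a : ℕ → X → ℝ) (b : ℝ → X → ℝ) (c : ℝ) : Prop :=
  ∀ (q n : ℕ) (lam D : ℝ), 2 ≤ q → q ≤ n → 0 < lam → lam ≤ 1 → 1 ≤ n * lam →
    ((n - n / q : ℕ) : ℝ) * lam ≤ 1 → 0 ≤ D → (∀ x, |a (n - n / q) x - b lam x| ≤ D) →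
    ∀ x, |a n x - b lam x| ≤ (1 - 1 / (2 * q)) * D + c / (q * (q - 1))

/-- Put r = n / q and n' = n - r. As n'λ ≤ 1 ≤ nλ, every m between n' and n has |1 - mλ| ≤ rλ ≤ r /
n' ≤ 1 / (q - 1). Dividing by n leaves the factors n' / n ≤ 1 - 1/(2q) and r / n ≤ 1/q. -/
theorem blockContraction_of_step {a : ℕ → X → ℝ} {b : ℝ → X → ℝ} {c : ℝ} (hc : 0 ≤ c)
    (h : ∀ (n r : ℕ) (lam D e : ℝ), 0 < lam → lam ≤ 1 → 0 ≤ D → 0 ≤ e →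
      (∀ m, n < m → m ≤ n + r → |1 - (m : ℝ) * lam| ≤ e) → 0 < n →
      (∀ x, |a n x - b lam x| ≤ D) →
      ∀ x, (n + r : ℕ) * |a (n + r) x - b lam x| ≤ n * D + r * (c * e)) :
    BlockContraction a b c := by
  intro q n lam D hq hqn h₀ h₁ hn hn' hD hx x
  set r := n / q with hr
  have hq0 : 0 < q := by omega
  have hrn : r * q ≤ n := Nat.div_mul_le_self n q
  have hr1 : 1 ≤ r := (Nat.one_le_div_iff hq0).2 hqn
  have hnr : n < q * (r + 1) := Nat.lt_mul_div_succ n hq0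
  have hr2 : 2 * r ≤ n := le_trans (by nlinarith) hrn
  set n' := n - r with hn'def
  have hsum : n' + r = n := by omega
  have hn'0 : 0 < n' := by omega
  have cn' : (0 : ℝ) < n' := by exact_mod_cast hn'0
  have cr : (1 : ℝ) ≤ r := by exact_mod_cast hr1
  have cq : (2 : ℝ) ≤ q := by exact_mod_cast hq
  have csum : (n' : ℝ) + r = n := by exact_mod_cast hsum
  have crn : (r : ℝ) * q ≤ n := by exact_mod_cast hrn
  -- The floor loses at most a factor 2, because r ≥ 1 gives r + 1 ≤ 2r.
  have cnr : (n : ℝ) ≤ 2 * q * r := by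
    have : (n : ℝ) < q * (r + 1) := by exact_mod_cast hnr
    nlinarith
  have cn : (0 : ℝ) < n := by linarith
  have key := h n' r lam D (r / n') h₀ h₁ hD (by positivity) ?_ hn'0 hx x
  · rw [hsum] at key
    have e₁ : (n' : ℝ) ≤ (1 - 1 / (2 * q)) * n := by
      have : (n : ℝ) / (2 * q) ≤ r := by rw [div_le_iff₀ (by positivity)]; linarith
      calc (n' : ℝ) = n - r := by linarith
        _ ≤ n - n / (2 * q) := by linarith
        _ = _ := by ring
    have e₂ : (r : ℝ) / n' ≤ 1 / (q - 1) := by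
      rw [div_le_div_iff₀ cn' (by linarith)]; nlinarith
    have e₃ : (r : ℝ) ≤ n / q := by rw [le_div_iff₀ (by positivity)]; exact crn
    have hq1 : (0 : ℝ) < q - 1 := by linarith
    have e₄ : (r : ℝ) * (c * (r / n')) ≤ n / q * (c * (1 / (q - 1))) := by gcongr
    have e₅ : (n : ℝ) * |a n x - b lam x| ≤
        n * ((1 - 1 / (2 * q)) * D + c / (q * (q - 1))) := by
      refine key.trans ((add_le_add (mul_le_mul_of_nonneg_right e₁ hD) e₄).trans_eq ?_)
      field_simp
    exact le_of_mul_le_mul_left e₅ cn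
  · intro m hm hm'
    have m₁ : (n' : ℝ) ≤ m := by exact_mod_cast hm.le
    have m₂ : (m : ℝ) ≤ n := by exact_mod_cast hm'.trans hsum.le
    have f₁ := mul_le_mul_of_nonneg_right m₁ h₀.le
    have f₂ := mul_le_mul_of_nonneg_right m₂ h₀.le
    have hrl : (r : ℝ) * lam ≤ r / n' := by
      rw [le_div_iff₀ cn']; nlinarith
    have f₃ : (n : ℝ) * lam = n' * lam + r * lam := by rw [← csum]; ring
    exact abs_le.2 ⟨by linarith, by linarith⟩

variable {a : ℕ → X → ℝ} {b : ℝ → X → ℝ} {c B : ℝ} {f : X → ℝ}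

/-- The fixed point without δ is 2c / (q - 1), hence small for large q. With q = m + 1 the allowance
is ε / (2q): the first term takes at most half of it and 2δ a quarter. -/
theorem exists_block_parameters (c : ℝ) {ε : ℝ} (hε : 0 < ε) : ∃ (q : ℕ) (δ : ℝ), 2 ≤ q ∧ 0 < δ ∧
    c / (q * (q - 1)) + 2 * δ < (1 - (1 - 1 / (2 * (q : ℝ)))) * ε := by
  obtain ⟨m, hm⟩ := exists_nat_gt (max 1 (4 * c / ε))
  have hm1 : (1 : ℝ) < m := (le_max_left _ _).trans_lt hm
  have hm2 : 4 * c < m * ε := by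
    have := (le_max_right _ _).trans_lt hm
    rwa [div_lt_iff₀ hε] at this
  have hq : (0 : ℝ) < m + 1 := by linarith
  refine ⟨m + 1, ε / (16 * (m + 1)), by
    have : 1 < m := by exact_mod_cast hm1
    omega, by positivity, ?_⟩
  push_cast
  rw [add_sub_cancel_right]
  have : c / ((m + 1) * m) ≤ ε / (4 * (m + 1)) := by
    rw [div_le_div_iff₀ (by positivity) (by positivity)]; nlinarith
  refine (add_le_add_left this _).trans_lt ?_
  field_simp
  norm_num

theorem BlockContraction.uniform_discounted (h : BlockContraction a b c) (hc : 0 ≤ c)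
    (ha : ∀ n x, |a n x| ≤ B) (hb : ∀ lam, 0 < lam → lam ≤ 1 → ∀ x, |b lam x| ≤ B) (hB : 0 ≤ B)
    (hf : ∀ ε > 0, ∀ᶠ n in atTop, ∀ x, |a n x - f x| ≤ ε) :
    ∀ ε > 0, ∀ᶠ lam in 𝓝[>] (0 : ℝ), ∀ x, |b lam x - f x| ≤ ε := by
  intro ε hε
  obtain ⟨q, δ, hq, hδ, hqδ⟩ := exists_block_parameters c hε
  have cq : (2 : ℝ) ≤ q := by exact_mod_cast hq
  have hi : 1 / (2 * (q : ℝ)) ≤ 1 := by rw [div_le_one (by linarith)]; linarith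
  have hi' : 0 < 1 / (2 * (q : ℝ)) := by positivity
  have hκ : 0 ≤ c / (q * ((q : ℝ) - 1)) := div_nonneg hc (by nlinarith)
  have hsmall : ∀ᶠ lam in 𝓝[>] (0 : ℝ), 0 < lam ∧ lam ≤ 1 := by
    filter_upwards [Ioc_mem_nhdsGT (zero_lt_one' ℝ)] with lam h using h
  obtain ⟨n₀, hn₀⟩ := eventually_atTop.1 (hf δ hδ)
  refine eventually_forall_abs_le_of_contraction (B := 2 * B + δ) (by positivity)
    (sub_nonneg.2 hi) (by linarith) (by positivity) ?_ ?_ hqδ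
  · filter_upwards [hsmall] with lam hl x
    have h₁ := hn₀ n₀ le_rfl x
    have h₂ := ha n₀ x
    have h₃ := hb lam hl.1 hl.2 x
    rw [abs_le] at *
    constructor <;> linarith
  · intro D hD hD'
    have hceil : Tendsto (fun lam : ℝ => ⌈lam⁻¹⌉₊) (𝓝[>] 0) atTop :=
      tendsto_nat_ceil_atTop.comp tendsto_inv_nhdsGT_zero
    -- As n - n / q ≥ n / 2, the bound 2n₀ ≤ n puts both indices beyond n₀. The error δ is paid
    -- twice: to replace f by `a` at n - n / q, and to return to f at n.
    filter_upwards [hsmall, hD', hceil.eventually_ge_atTop q,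
      hceil.eventually_ge_atTop (2 * n₀)] with lam hl hx hnq hn2 x
    set n := ⌈lam⁻¹⌉₊ with hn
    have hhalf : n / q ≤ n / 2 := Nat.div_le_div_left hq two_pos
    have hr1 : 1 ≤ n / q := (Nat.one_le_div_iff (by omega)).2 hnq
    have l₁ : 1 ≤ (n : ℝ) * lam := by
      have := Nat.le_ceil lam⁻¹
      rwa [inv_le_iff_one_le_mul₀ hl.1] at this
    have l₂ : ((n - n / q : ℕ) : ℝ) * lam ≤ 1 := by
      have h₁ := Nat.ceil_lt_add_one (inv_pos.2 hl.1).le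
      have h₂ : ((n - n / q : ℕ) : ℝ) + 1 ≤ n := by
        exact_mod_cast (by omega : n - n / q + 1 ≤ n)
      rw [← le_div_iff₀ hl.1, one_div]
      linarith
    have g₁ := hn₀ n (by omega)
    have g₂ := hn₀ (n - n / q) (by omega)
    have := h q n lam (D + δ) hq hnq hl.1 hl.2 l₁ l₂ (by positivity) (fun x => by
      have h₁ := g₂ x
      have h₂ := hx x
      rw [abs_le] at *
      constructor <;> linarith) x
    have h₁ := g₁ x
    have h₂ : (1 - 1 / (2 * (q : ℝ))) * δ ≤ δ := mul_le_of_le_one_left hδ.le (by linarith)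
    rw [mul_add] at this
    rw [abs_le] at *
    constructor <;> linarith

theorem BlockContraction.uniform_nStage (h : BlockContraction a b c) (hc : 0 ≤ c)
    (ha : ∀ n x, |a n x| ≤ B) (hb : ∀ lam, 0 < lam → lam ≤ 1 → ∀ x, |b lam x| ≤ B) (hB : 0 ≤ B)
    (hf : ∀ ε > 0, ∀ᶠ lam in 𝓝[>] (0 : ℝ), ∀ x, |b lam x - f x| ≤ ε) :
    ∀ ε > 0, ∀ᶠ n in atTop, ∀ x, |a n x - f x| ≤ ε := by
  intro ε hε
  obtain ⟨q, δ, hq, hδ, hqδ⟩ := exists_block_parameters c hε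
  have cq : (2 : ℝ) ≤ q := by exact_mod_cast hq
  have hi : 1 / (2 * (q : ℝ)) ≤ 1 := by rw [div_le_one (by linarith)]; linarith
  have hi' : 0 < 1 / (2 * (q : ℝ)) := by positivity
  have hκ : 0 ≤ c / (q * ((q : ℝ) - 1)) := div_nonneg hc (by nlinarith)
  have hsmall : ∀ᶠ lam in 𝓝[>] (0 : ℝ), 0 < lam ∧ lam ≤ 1 := by
    filter_upwards [Ioc_mem_nhdsGT (zero_lt_one' ℝ)] with lam h using h
  have hinv : Tendsto (fun n : ℕ => ((n : ℝ))⁻¹) atTop (𝓝[>] 0) :=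
    tendsto_inv_atTop_nhdsGT_zero.comp tendsto_natCast_atTop_atTop
  refine eventually_forall_abs_le_of_contraction (B := 2 * B + δ) (by positivity)
    (sub_nonneg.2 hi) (by linarith) (by positivity) ?_ ?_ hqδ
  · obtain ⟨lam, hl, hx⟩ := (hsmall.and (hf δ hδ)).exists
    refine Eventually.of_forall fun n x => ?_
    have h₁ := hx x
    have h₂ := ha n x
    have h₃ := hb lam hl.1 hl.2 x
    rw [abs_le] at *
    constructor <;> linarith
  · intro D hD hD'
    obtain ⟨n₀, hn₀⟩ := eventually_atTop.1 hD'
    -- Here λ = 1/n is fixed over the block, and the bound D is used at the earlier index n - n / q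
    -- ≥ n₀.
    filter_upwards [hinv.eventually hsmall, hinv.eventually (hf δ hδ), eventually_ge_atTop q,
      eventually_ge_atTop (2 * n₀)] with n hl hx hnq hn2 x
    have hhalf : n / q ≤ n / 2 := Nat.div_le_div_left hq two_pos
    have cn : (0 : ℝ) < n := by exact_mod_cast (by omega : 0 < n)
    have l₂ : ((n - n / q : ℕ) : ℝ) * (n : ℝ)⁻¹ ≤ 1 := by
      rw [← div_eq_mul_inv, div_le_one cn]
      exact_mod_cast Nat.sub_le _ _
    have g₂ := hn₀ (n - n / q) (by omega)
    have := h q n (n : ℝ)⁻¹ (D + δ) hq hnq hl.1 hl.2 (mul_inv_cancel₀ cn.ne').ge l₂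
      (by positivity) (fun x => by
        have h₁ := g₂ x
        have h₂ := hx x
        rw [abs_le] at *
        constructor <;> linarith) x
    have h₁ := hx x
    have h₂ : (1 - 1 / (2 * (q : ℝ))) * δ ≤ δ := mul_le_of_le_one_left hδ.le (by linarith)
    rw [mul_add] at this
    rw [abs_le] at *
    constructor <;> linarith

end Tauberian

/-! ### From pointwise to uniform convergence. -/

/-- On a compact space, an equi-Lipschitz family which converges pointwise converges uniformly. -/
theorem uniform_of_pointwise {X ι : Type*} [PseudoMetricSpace X] [CompactSpace X] {l : Filter ι}
    [l.NeBot] {F : ι → X → ℝ} {f : X → ℝ} {L : ℝ} (hL : 0 ≤ L)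
    (hF : ∀ᶠ i in l, ∀ x y, |F i x - F i y| ≤ L * dist x y)
    (hf : ∀ x, Tendsto (fun i => F i x) l (𝓝 (f x))) :
    ∀ ε > 0, ∀ᶠ i in l, ∀ x, |F i x - f x| ≤ ε := by
  intro ε hε
  have hfL : ∀ x y, |f x - f y| ≤ L * dist x y := fun x y =>
    le_of_tendsto ((hf x).sub (hf y)).abs (hF.mono fun i hi => hi x y)
  have hδ : 0 < ε / (3 * (L + 1)) := by positivity
  obtain ⟨t, -, ht, hcov⟩ := finite_cover_balls_of_compact (isCompact_univ (X := X)) hδ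
  have hpt : ∀ᶠ i in l, ∀ y ∈ t, |F i y - f y| ≤ ε / 3 := by
    rw [ht.eventually_all]
    intro y _
    filter_upwards [(hf y).eventually (Metric.closedBall_mem_nhds (f y) (by positivity : 0 < ε / 3))]
      with i hi
    rwa [← Real.dist_eq]
  filter_upwards [hF, hpt] with i hi hi' x
  obtain ⟨y, hy, hxy⟩ := Set.mem_iUnion₂.1 (hcov (Set.mem_univ x))
  have hd : L * dist x y ≤ ε / 3 := by
    have h₁ : dist x y ≤ ε / (3 * (L + 1)) := (Metric.mem_ball.1 hxy).le
    calc L * dist x y ≤ (L + 1) * (ε / (3 * (L + 1))) := by gcongr; linarith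
      _ = ε / 3 := by field_simp
  have h₁ := (hi x y).trans hd
  have h₂ := hi' y hy
  have h₃ := (hfL x y).trans hd
  rw [abs_le] at *
  constructor <;> linarith

/-! ### Regularity of the values in the belief, and conclusion. -/

namespace HiddenStochasticGame

variable {K I J A : Type*} [Fintype K]

/-- With homogeneity, this extends estimates from the simplex to all nonnegative beliefs, as the
one-step comparison requires. -/
theorem eq_zero_or_eq_mass_smul {u : K → ℝ} (hu : 0 ≤ u) :
    u = 0 ∨ ∃ p : stdSimplex ℝ K, u = mass u • p.1 := by
  have hm : mass u = ∑ k, u k := Finset.sum_congr rfl fun k _ => abs_of_nonneg (hu k)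
  rcases (mass_nonneg u).eq_or_lt with h | h
  · left
    ext k
    rw [hm, eq_comm, Finset.sum_eq_zero_iff_of_nonneg fun k _ => hu k] at h
    exact h k (Finset.mem_univ k)
  · right
    refine ⟨⟨(mass u)⁻¹ • u, fun k => mul_nonneg (inv_pos.2 h).le (hu k), ?_⟩, ?_⟩
    · simp only [Pi.smul_apply, smul_eq_mul]
      rw [← Finset.mul_sum, ← hm, inv_mul_cancel₀ h.ne']
    · rw [smul_smul, mul_inv_cancel₀ h.ne', one_smul]

/-- The simplex carries the sup distance, whence the factor `Fintype.card K`. -/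
theorem mass_sub_le_dist (p p' : stdSimplex ℝ K) :
    mass (p.1 - p'.1) ≤ Fintype.card K * dist p p' := by
  rw [← nsmul_eq_mul]
  exact Finset.sum_le_card_nsmul _ _ _ fun k _ => dist_le_pi_dist p.1 p'.1 k

variable [Fintype I] [Fintype J] [Fintype A] [Nonempty I] [Nonempty J]

theorem abs_nStageValue_le (G : HiddenStochasticGame K I J A) (n : ℕ) (p : stdSimplex ℝ K) :
    |G.nStageValue n p| ≤ G.payoffBound := by
  have hb := G.abs_nStagePayoff_le n p
  obtain ⟨h₁, h₂, h₃⟩ := value_bounds (v := 0) (ε := G.payoffBound) hb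
    (Classical.arbitrary _) (Classical.arbitrary _)
    (fun τ => by linarith [(abs_le.1 (hb (Classical.arbitrary _) τ)).1])
    (fun σ => by linarith [(abs_le.1 (hb σ (Classical.arbitrary _))).2])
  exact abs_le.2 ⟨by rw [nStageValue]; linarith, by rw [nStageValue]; linarith⟩

theorem abs_discountedValue_le (G : HiddenStochasticGame K I J A) {lam : ℝ} (h₀ : 0 < lam)
    (h₁ : lam ≤ 1) (p : stdSimplex ℝ K) : |G.discountedValue lam p| ≤ G.payoffBound := by
  refine le_of_tendsto' (G.tendsto_finiteValue_discount h₀ h₁ p).abs fun N => ?_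
  simpa [mass_coe] using G.abs_finiteValue_discount_le h₀ h₁ N p.1

theorem abs_discountedValue_sub_le (G : HiddenStochasticGame K I J A) {lam : ℝ} (h₀ : 0 < lam)
    (h₁ : lam ≤ 1) (p p' : stdSimplex ℝ K) :
    |G.discountedValue lam p - G.discountedValue lam p'| ≤
      (G.payoffBound * Fintype.card K) * dist p p' := by
  refine le_of_tendsto' ((G.tendsto_finiteValue_discount h₀ h₁ p).sub
    (G.tendsto_finiteValue_discount h₀ h₁ p')).abs fun N => ?_
  refine (G.abs_finiteValue_sub_le N _ _ _).trans ?_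
  rw [mul_assoc G.payoffBound (Fintype.card K : ℝ)]
  exact mul_le_mul (mul_le_of_le_one_right G.payoffBound_nonneg (sum_abs_discount_le h₀ h₁ N))
    (mass_sub_le_dist p p') (mass_nonneg _) G.payoffBound_nonneg

theorem abs_nStageValue_sub_le (G : HiddenStochasticGame K I J A) (n : ℕ)
    (p p' : stdSimplex ℝ K) : |G.nStageValue n p - G.nStageValue n p'| ≤
      (G.payoffBound * Fintype.card K) * dist p p' := by
  rw [nStageValue, nStageValue, (G.nStage_value n p).1, (G.nStage_value n p').1, ← mul_sub,
    abs_mul, abs_of_nonneg (by positivity : 0 ≤ (n : ℝ)⁻¹), mul_assoc G.payoffBound]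
  have h := G.abs_finiteValue_sub_le n (fun _ => 1) p.1 p'.1
  have hd := mass_sub_le_dist p p'
  have hC := G.payoffBound_nonneg
  have hn : (n : ℝ)⁻¹ * n ≤ 1 := inv_mul_le_one
  simp only [abs_one, Finset.sum_const, Finset.card_range, nsmul_eq_mul, mul_one] at h
  calc _ ≤ (n : ℝ)⁻¹ * (G.payoffBound * n * mass (p.1 - p'.1)) := by gcongr
    _ = ((n : ℝ)⁻¹ * n) * (G.payoffBound * mass (p.1 - p'.1)) := by ring
    _ ≤ 1 * (G.payoffBound * (Fintype.card K * dist p p')) := by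
      have := mass_nonneg (p.1 - p'.1)
      gcongr
    _ = _ := one_mul _

/-- If the distance between the `n`-stage value and the discounted value is at most `D`, then it can
be controlled after `r` further stages, when the discount factor is about the inverse of the number
of stages. -/
theorem abs_nStageValue_sub_discountedValue_le (G : HiddenStochasticGame K I J A) (n r : ℕ)
    (lam D e : ℝ) (h₀ : 0 < lam) (h₁ : lam ≤ 1) (hD : 0 ≤ D) (he : 0 ≤ e)
    (hr : ∀ m, n < m → m ≤ n + r → |1 - (m : ℝ) * lam| ≤ e) (hn : 0 < n)
    (h : ∀ p, |G.nStageValue n p - G.discountedValue lam p| ≤ D) (p : stdSimplex ℝ K) :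
    (n + r : ℕ) * |G.nStageValue (n + r) p - G.discountedValue lam p| ≤
      n * D + r * (2 * G.payoffBound * e) := by
  have hC := G.payoffBound_nonneg
  have htotal : ∀ m, 0 < m → ∀ p, G.finiteValue (fun _ => 1) m p.1 = m * G.nStageValue m p := by
    intro m hm p
    have : (m : ℝ) ≠ 0 := by exact_mod_cast hm.ne'
    rw [nStageValue, (G.nStage_value m p).1, mul_inv_cancel_left₀ this]
  -- The discounted game is truncated at N stages before the block and N + r after it; letting N
  -- tend to infinity removes the truncation error.
  have hN : ∀ N : ℕ, |((n + r : ℕ) * G.nStageValue (n + r) p) -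
      (n + r : ℕ) * G.finiteValue (discount lam) (N + r) p.1| ≤
      n * (D + (1 - lam) ^ N * G.payoffBound) + r * (2 * G.payoffBound * e) := by
    intro N
    have hp : 0 ≤ (1 - lam) ^ N := pow_nonneg (by linarith) N
    have hstart : ∀ p : stdSimplex ℝ K,
        |G.finiteValue (fun _ => 1) n p.1 - n * G.finiteValue (discount lam) N p.1| ≤
          n * (D + (1 - lam) ^ N * G.payoffBound) := by
      intro p
      rw [htotal n hn, ← mul_sub, abs_mul, Nat.abs_cast]
      refine mul_le_mul_of_nonneg_left ?_ (Nat.cast_nonneg n)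
      obtain ⟨c₁, c₂, c₃⟩ := G.discounted_value_bounds h₀ h₁ p N
      have := abs_le.1 (h p)
      rw [discountedValue] at this
      exact abs_le.2 ⟨by linarith, by linarith⟩
    have := G.abs_finiteValue_add_sub_discount_le (D := n * (D + (1 - lam) ^ N * G.payoffBound))
      h₀ h₁ (by positivity) he n N (fun u hu => by
      rcases eq_zero_or_eq_mass_smul hu with rfl | ⟨p, hp⟩
      · have hz : ∀ w N, G.finiteValue w N 0 = 0 := fun w N => by
          simpa using G.finiteValue_smul le_rfl N w 0
        simp [hz, mass]
      · have hm := mass_nonneg u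
        have hs := mul_le_mul_of_nonneg_left (hstart p) hm
        rw [← abs_of_nonneg hm, ← abs_mul, abs_of_nonneg hm] at hs
        conv_lhs => rw [hp, G.finiteValue_smul hm, G.finiteValue_smul hm]
        rw [mul_comm _ (mass u)]
        refine le_trans (le_of_eq ?_) hs
        congr 1; ring) r hr p.1 p.2.1
    rwa [htotal _ (by omega), mass_coe, mul_one] at this
  rw [← Nat.abs_cast (n + r), ← abs_mul, mul_sub]
  have hlim := ((G.tendsto_pow_mul_payoffBound h₀ h₁).const_add D).const_mul (n : ℝ)
    |>.add_const ((r : ℝ) * (2 * G.payoffBound * e))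
  rw [add_zero] at hlim
  refine le_of_tendsto_of_tendsto' (((((tendsto_add_atTop_iff_nat r).2
    (G.tendsto_finiteValue_discount h₀ h₁ p)).const_mul _).const_sub _).abs) hlim hN

theorem blockContraction (G : HiddenStochasticGame K I J A) :
    BlockContraction G.nStageValue G.discountedValue (2 * G.payoffBound) :=
  blockContraction_of_step (mul_nonneg zero_le_two G.payoffBound_nonneg)
    G.abs_nStageValue_sub_discountedValue_le

theorem tendsto_discountedValue (G : HiddenStochasticGame K I J A) {f : stdSimplex ℝ K → ℝ}
    (hf : ∀ p, Tendsto (fun n => G.nStageValue n p) atTop (𝓝 (f p))) (p : stdSimplex ℝ K) :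
    Tendsto (fun lam => G.discountedValue lam p) (𝓝[>] 0) (𝓝 (f p)) := by
  have hC := G.payoffBound_nonneg
  have h := G.blockContraction.uniform_discounted (by positivity) G.abs_nStageValue_le
    (fun _ => G.abs_discountedValue_le) hC
    (uniform_of_pointwise (by positivity) (Eventually.of_forall G.abs_nStageValue_sub_le) hf)
  exact Metric.nhds_basis_closedBall.tendsto_right_iff.2 fun ε hε =>
    (h ε hε).mono fun lam hl => by simpa [Real.dist_eq] using hl p

theorem tendsto_nStageValue (G : HiddenStochasticGame K I J A) {f : stdSimplex ℝ K → ℝ}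
    (hf : ∀ p, Tendsto (fun lam => G.discountedValue lam p) (𝓝[>] 0) (𝓝 (f p)))
    (p : stdSimplex ℝ K) : Tendsto (fun n => G.nStageValue n p) atTop (𝓝 (f p)) := by
  have hC := G.payoffBound_nonneg
  have hlip : ∀ᶠ lam in 𝓝[>] (0 : ℝ), ∀ p p',
      |G.discountedValue lam p - G.discountedValue lam p'| ≤
        (G.payoffBound * Fintype.card K) * dist p p' := by
    filter_upwards [Ioc_mem_nhdsGT (zero_lt_one' ℝ)] with lam hl p p'
      using G.abs_discountedValue_sub_le hl.1 hl.2 p p'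
  have h := G.blockContraction.uniform_nStage (by positivity) G.abs_nStageValue_le
    (fun _ => G.abs_discountedValue_le) hC (uniform_of_pointwise (by positivity) hlip hf)
  exact Metric.nhds_basis_closedBall.tendsto_right_iff.2 fun ε hε =>
    (h ε hε).mono fun n hn => by simpa [Real.dist_eq] using hn p

end HiddenStochasticGame

theorem proposition3 {K I J A : Type*} [Fintype K] [Fintype I] [Fintype J] [Fintype A]
    [Nonempty I] [Nonempty J] (G : HiddenStochasticGame K I J A) :
    -- all the games have a value
    (∀ n : ℕ, 1 ≤ n → ∀ p : stdSimplex ℝ K,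
      lowerValue (G.nStagePayoff n p) = upperValue (G.nStagePayoff n p)) ∧
    (∀ lam : ℝ, 0 < lam → lam ≤ 1 → ∀ p : stdSimplex ℝ K,
      lowerValue (G.discountedPayoff lam p) = upperValue (G.discountedPayoff lam p)) ∧
    -- equivalence of the convergence of the two families of values
    ((∀ p : stdSimplex ℝ K, ∃ l : ℝ, Tendsto (fun n : ℕ => G.nStageValue n p) atTop (𝓝 l)) ↔
      (∀ p : stdSimplex ℝ K, ∃ l : ℝ,
        Tendsto (fun lam : ℝ => G.discountedValue lam p) (𝓝[>] 0) (𝓝 l))) ∧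
    -- in this case the limits are equal
    ((∀ p : stdSimplex ℝ K, ∃ l : ℝ, Tendsto (fun n : ℕ => G.nStageValue n p) atTop (𝓝 l)) →
      ∀ p : stdSimplex ℝ K, ∃ l : ℝ,
        Tendsto (fun n : ℕ => G.nStageValue n p) atTop (𝓝 l) ∧
        Tendsto (fun lam : ℝ => G.discountedValue lam p) (𝓝[>] 0) (𝓝 l)) := by
  refine ⟨fun n _ p => (G.nStage_value n p).2,
    fun lam h₀ h₁ p => G.discounted_lowerValue_eq_upperValue h₀ h₁ p, ⟨fun h => ?_, fun h => ?_⟩,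
    fun h => ?_⟩
  · choose f hf using h
    exact fun p => ⟨f p, G.tendsto_discountedValue hf p⟩
  · choose f hf using h
    exact fun p => ⟨f p, G.tendsto_nStageValue hf p⟩
  · choose f hf using h
    exact fun p => ⟨f p, hf p, G.tendsto_discountedValue hf p⟩
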